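/- Let $b\ge 2$, $m\ge 1$ and $s$ be integers with $s\le b$, let $J\subseteq\{1,\dots,s\}$ and $k\in\mathbb N_0^s$, and write $|k|=\sum_{j=1}^s k_j$, $|k|_S=\sum_{j\in S}k_j$, $J^c=\{1,\dots,s\}\setminus J$, and $I^*=I\cup J^c$ for $I\subseteq J$. For integers $0\le i<j$ and $\ell\in\mathbb Z$ put $$g_{j,i}(\ell)=\begin{cases}0&\text{if }\ell\le 2i,\\ 1&\text{if }\ell\ge i+j,\text{ or if }\ell>2i\text{ and }\ell\text{ is even},\\ \left(\frac{b}{b-1}\right)^{j-i-1}&\text{if }\ell=2i+1,\\ 1+\frac{b^{j+i-\ell}}{(b-1)^{j-i}}\binom{j-i-1}{\ell-2i}&\text{if }2i+1<\ell<i+j\text{ and }\ell\text{ is odd}\end{cases}$$ (the cases agree where they overlap), and let $G(m,s,J,k,0)=\sum_{I\subsetneq J}g_{|J|,|I|}(m-|k|_{I^*})$. For $x\ne y$ in $[0,1)$ let $\gamma_b(x,y)$ be the unique integer $i\ge 0$ with $\lfloor b^ix\rfloor=\lfloor b^iy\rfloor$ and $\lfloor b^{i+1}x\rfloor\ne\lfloor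 b^{i+1}y\rfloor$, and let $\gamma_b(x,x)=\infty$. Let $n=b^m$. A $(0,m,s)$-net in base $b$ is a family $P_n=(u_1,\dots,u_n)$ of points of $[0,1)^s$ such that every interval $\prod_{j=1}^s[a_jb^{-d_j},(a_j+1)b^{-d_j})$ with integers $d_j\ge 0$, $0\le a_j<b^{d_j}$ and $\sum_j d_j=m$ contains exactly one of the points. Given a base point $u_i\in P_n$ and $I\subseteq J$, let $m_b(k,0,2,J,I;P_n)$ be the number of $\ell\ne i$ such that $\gamma_b(u_{i,j},u_{\ell,j})\ge k_j+2$ for $j\in I$, $\gamma_b(u_{i,j},u_{\ell,j})\ge k_j$ for $j\in J^c$, and $\gamma_b(u_{i,j},u_{\ell,j})=0$ for $j\in J\setminus I$; and let $$\tilde m_b(k,0,J;P_n)=\frac1{2^{|J|}}\sum_{I\subseteq J}b^{|k|_{I^*}+|J|+|I|}(b-1)^{|I|-|J|}\,\frac{m_b(k,0,2,J,I;P_n)}{n-1}.$$ Suppose that $|J|\le m<|k|+2|J|$. Then $$G(m,s,J,k,0)\le 2^{|J|}-1,$$ and every $(0,m,s)$-net $P_n$ in base $b$ satisfies $\tilde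 m_b(k,0,J;P_n)\le 1$, for every choice of the base point $u_i$. -/

import Mathlib

open Finset

noncomputable section

namespace Nets

/-- `P` is a `(t, m, s)`-net in base `b`: `b ^ m` points of `[0,1)^s`, listed with multiplicity,
such that every elementary interval `∏ j, [a j / b ^ (d j), (a j + 1) / b ^ (d j))` of volume
`b ^ (t - m)` contains exactly `b ^ t` of them. -/
structure IsNet (b t m : ℕ) {s : ℕ} (P : Fin (b ^ m) → Fin s → ℝ) : Prop where
  mem_unit : ∀ l j, P l j ∈ Set.Ico (0 : ℝ) 1
  t_le : t ≤ m
  ncard_eq : ∀ d a : Fin s → ℕ, (∑ j, d j) + t = m → (∀ j, a j < b ^ d j) →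
    {l : Fin (b ^ m) | ∀ j, P l j ∈
      Set.Ico ((a j : ℝ) / (b : ℝ) ^ d j) (((a j : ℝ) + 1) / (b : ℝ) ^ d j)}.ncard = b ^ t

open Classical in
/-- The exact number `γ_b(x, y)` of initial base `b` digits shared by `x, y ∈ [0,1)`: it is `∞` if
`x = y`, and otherwise it is the unique `i` with `⌊b ^ i x⌋ = ⌊b ^ i y⌋` and
`⌊b ^ (i + 1) x⌋ ≠ ⌊b ^ (i + 1) y⌋`. -/
def gam (b : ℕ) (x y : ℝ) : ℕ∞ :=
  if x = y then ⊤ else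
    ((sInf {i : ℕ | ⌊(b : ℝ) ^ i * x⌋ = ⌊(b : ℝ) ^ i * y⌋ ∧
      ⌊(b : ℝ) ^ (i + 1) * x⌋ ≠ ⌊(b : ℝ) ^ (i + 1) * y⌋} : ℕ) : ℕ∞)

/-- The counting number `m_b(k, d, c, J, I; P)` relative to the base point `P i`. -/
def countNum (b : ℕ) {n s : ℕ} (P : Fin n → Fin s → ℝ) (k d : Fin s → ℕ) (c : ℕ)
    (J I : Finset (Fin s)) (i : Fin n) : ℕ :=
  {l : Fin n | l ≠ i ∧
    (∀ j ∈ I, ((k j + d j + c : ℕ) : ℕ∞) ≤ gam b (P i j) (P l j)) ∧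
    (∀ j ∈ Jᶜ, (k j : ℕ∞) ≤ gam b (P i j) (P l j)) ∧
    (∀ j ∈ J \ I, gam b (P i j) (P l j) = (d j : ℕ∞))}.ncard

/-- The weighted sum of counting numbers `m̃_b(k, d, J; P)`, relative to the base point `P i`;
here `I* = I ∪ Jᶜ`. -/
def weightedCount (b : ℕ) {n s : ℕ} (k d : Fin s → ℕ) (J : Finset (Fin s))
    (P : Fin n → Fin s → ℝ) (i : Fin n) : ℝ :=
  1 / (2 : ℝ) ^ #J * ∑ I ∈ J.powerset,
    (b : ℝ) ^ ((∑ j ∈ I ∪ Jᶜ, k j) + (∑ j ∈ J, d j) + #J + #I) *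
      ((b : ℝ) - 1) ^ ((#I : ℤ) - (#J : ℤ)) *
      ((countNum b P k d 2 J I i : ℝ) / ((n : ℝ) - 1))

/-- `h_{j,i}(ℓ) = b^{j+i-ℓ} / (b-1)^{j-i} * (j-i-1 choose ℓ-2i)`, used only for
`0 ≤ i < j` and `2i + 1 < ℓ < j + i`. -/
def h (b j i : ℕ) (l : ℤ) : ℝ :=
  (b : ℝ) ^ ((j : ℤ) + i - l) / ((b : ℝ) - 1) ^ (j - i) *
    (Nat.choose (j - i - 1) (l - 2 * i).toNat : ℝ)

/-- The function `g_{j,i}(ℓ)`, used only for `0 ≤ i < j`. -/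
def g (b j i : ℕ) (l : ℤ) : ℝ :=
  if l ≤ 2 * i then 0
  else if (i : ℤ) + j ≤ l ∨ Even l then 1
  else if l = 2 * i + 1 then ((b : ℝ) / ((b : ℝ) - 1)) ^ (j - i - 1)
  else 1 + h b j i l

/-- `G(m, s, J, k, d)`: the sum over the proper subsets `I` of `J` of
`g_{|J|,|I|}(m - |k|_{I*} - |d|_J)`, with `I* = I ∪ Jᶜ`. -/
def G (b m s : ℕ) (J : Finset (Fin s)) (k d : Fin s → ℕ) : ℝ :=
  ∑ I ∈ J.ssubsets,
    g b #J #I ((m : ℤ) - ((∑ j ∈ I ∪ Jᶜ, k j : ℕ) : ℤ) - ((∑ j ∈ J, d j : ℕ) : ℤ))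

end Nets

end

/-! Put X(I) = m - |k|_{I*} - 2|I|; enlarging I by u elements lowers X by at least 2u. The summand
of G at I is 0 if X(I) ≤ 0, and otherwise 1, plus an excess if X(I) = 2u - 1 is odd. So G ≤ 2^|J| -
1 says that the total excess is at most the number of proper subsets with X ≤ 0. Each such I spreads
its excess evenly over the sets Z = I ∪ T with T ⊆ J \ I and |T| = u; there X(Z) ≤ -1, so Z has a
free unit of room. What Z receives depends only on |Z| and |J \ Z|, and it is at most 1 because |J|
≤ b (`sum_share_le_one`, `sum_excess_le`).

For a net, inclusion-exclusion over the first digits in J \ I turns the count into a truncated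
alternating binomial sum (`countNum_eq_truncCount`), which the function g dominates after
normalisation (`truncCount_le_g`). Hence the weighted sum is at most b^m / (b^m - 1) * (2^|J| - 1)
before division by 2^|J|, and 2^|J| ≤ b^m finishes. -/

noncomputable section

namespace Nets

/-! ### Truncated alternating binomial sums -/

/-- The alternating sum `∑_{q ≤ X} (-1)^q (r choose q) b^(X-q)`. -/
def truncSum (b : ℝ) (r X : ℕ) : ℝ :=
  ∑ q ∈ range (X + 1), (-1) ^ q * (r.choose q : ℝ) * b ^ (X - q)

lemma truncSum_succ (b : ℝ) (r X : ℕ) :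
    truncSum b r (X + 1) = b * truncSum b r X + (-1) ^ (X + 1) * (r.choose (X + 1) : ℝ) := by
  unfold truncSum
  rw [sum_range_succ _ (X + 1), mul_sum]
  congr 1
  · refine sum_congr rfl fun q hq => ?_
    have : X + 1 - q = X - q + 1 := by have := mem_range.1 hq; omega
    rw [this, pow_succ]; ring
  · simp

lemma pow_mul_truncSum_of_le (b : ℝ) {r X : ℕ} (hX : r ≤ X) :
    b ^ r * truncSum b r X = b ^ X * (b - 1) ^ r := by
  obtain ⟨t, rfl⟩ := Nat.exists_eq_add_of_le hX
  induction t with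
  | zero =>
    have : truncSum b r r = (b - 1) ^ r := by
      rw [show b - 1 = -1 + b by ring, add_pow]
      exact sum_congr rfl fun q _ => by ring
    simp [this]
  | succ t ih =>
    rw [← add_assoc, truncSum_succ, Nat.choose_eq_zero_of_lt (by omega)]
    have := ih (by omega)
    rw [pow_succ b (r + t)]
    push_cast
    linear_combination b * this

/-- Descending induction on X, starting where X ≥ r and the error vanishes. If e(X) is the signed
error, then b e(X) = b^r (r choose X+1) - e(X+1). The upper bound on e(X+1) keeps this nonnegative,
since (r choose X+2) ≤ b (r choose X+1) for r ≤ b. -/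
lemma truncSum_bounds {b r : ℕ} (hb : 1 ≤ b) (hr : r ≤ b) (X : ℕ) :
    0 ≤ (-1 : ℝ) ^ X * ((b : ℝ) ^ r * truncSum b r X - (b : ℝ) ^ X * ((b : ℝ) - 1) ^ r) ∧
    b * ((-1 : ℝ) ^ X * ((b : ℝ) ^ r * truncSum b r X - (b : ℝ) ^ X * ((b : ℝ) - 1) ^ r)) ≤
      (b : ℝ) ^ r * (r.choose (X + 1) : ℝ) := by
  obtain ⟨t, ht⟩ : ∃ t, r - X = t := ⟨_, rfl⟩
  induction t generalizing X with
  | zero =>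
    rw [pow_mul_truncSum_of_le _ (by omega : r ≤ X), sub_self]
    simp only [mul_zero, le_refl, true_and]
    positivity
  | succ t ih =>
    obtain ⟨h1, h2⟩ := ih (X + 1) (by omega)
    have hb0 : (0 : ℝ) < b := by exact_mod_cast hb
    have hs : ((-1 : ℝ) ^ X) ^ 2 = 1 := by rw [← pow_mul, mul_comm, pow_mul]; norm_num
    have key : (b : ℝ) * ((-1 : ℝ) ^ X *
        ((b : ℝ) ^ r * truncSum b r X - (b : ℝ) ^ X * ((b : ℝ) - 1) ^ r)) =
        (b : ℝ) ^ r * (r.choose (X + 1) : ℝ) - (-1 : ℝ) ^ (X + 1) *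
          ((b : ℝ) ^ r * truncSum b r (X + 1) - (b : ℝ) ^ (X + 1) * ((b : ℝ) - 1) ^ r) := by
      rw [truncSum_succ, pow_succ (-1 : ℝ) X, pow_succ (b : ℝ) X]
      linear_combination ((b : ℝ) ^ r * (r.choose (X + 1) : ℝ)) * hs
    have hc : (r.choose (X + 1 + 1) : ℝ) ≤ b * (r.choose (X + 1) : ℝ) := by
      have := Nat.choose_succ_right_eq r (X + 1)
      have h3 : r.choose (X + 1 + 1) ≤ b * r.choose (X + 1) := by
        calc r.choose (X + 1 + 1) ≤ r.choose (X + 1 + 1) * (X + 1 + 1) :=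
              Nat.le_mul_of_pos_right _ (by omega)
          _ = r.choose (X + 1) * (r - (X + 1)) := this
          _ ≤ r.choose (X + 1) * b := Nat.mul_le_mul_left _ (by omega)
          _ = _ := mul_comm _ _
      exact_mod_cast h3
    have hp : (0 : ℝ) < (b : ℝ) ^ r := by positivity
    refine ⟨?_, by rw [key]; linarith⟩
    refine nonneg_of_mul_nonneg_right ?_ hb0
    rw [key]
    refine sub_nonneg.2 (le_of_mul_le_mul_left (h2.trans ?_) hb0)
    calc (b : ℝ) ^ r * (r.choose (X + 1 + 1) : ℝ) ≤ (b : ℝ) ^ r * (b * (r.choose (X + 1) : ℝ)) :=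
          mul_le_mul_of_nonneg_left hc hp.le
      _ = _ := by ring

/-- The alternating sum `∑_{q ≤ X} (-1)^q (r choose q) (b^(X-q) - 1)`. -/
def truncCount (b : ℝ) (r X : ℕ) : ℝ :=
  ∑ q ∈ range (X + 1), (-1) ^ q * (r.choose q : ℝ) * (b ^ (X - q) - 1)

lemma truncCount_eq (b : ℝ) (r X : ℕ) :
    truncCount b (r + 1) X = truncSum b (r + 1) X - (-1) ^ X * (r.choose X : ℝ) := by
  have h : ∑ q ∈ range (X + 1), (-1 : ℝ) ^ q * ((r + 1).choose q : ℝ) =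
      (-1) ^ X * (r.choose X : ℝ) := by
    exact_mod_cast Int.alternating_sum_range_choose_eq_choose (n := r) (m := X)
  rw [← h, truncSum, ← sum_sub_distrib]
  exact sum_congr rfl fun q _ => by ring

/-- For even X the truncation error is positive, but the subtracted binomial (r choose X) absorbs
it. For odd X that binomial enters with a plus sign and survives, which is the source of the excess
in g. -/
lemma pow_mul_truncCount_le_of_even {b r : ℕ} (hb : 1 ≤ b) (hr : r + 1 ≤ b) {X : ℕ}
    (hX : Even X) :
    (b : ℝ) ^ (r + 1) * truncCount b (r + 1) X ≤ (b : ℝ) ^ X * ((b : ℝ) - 1) ^ (r + 1) := by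
  have h2 := (truncSum_bounds hb hr X).2
  rw [truncCount_eq, hX.neg_one_pow, one_mul]
  rw [hX.neg_one_pow, one_mul] at h2
  have hb0 : (0 : ℝ) < b := by exact_mod_cast hb
  have hc : ((r + 1).choose (X + 1) : ℝ) ≤ b * (r.choose X : ℝ) := by
    have h3 : (r + 1).choose (X + 1) ≤ b * r.choose X := by
      calc (r + 1).choose (X + 1) ≤ (r + 1).choose (X + 1) * (X + 1) :=
            Nat.le_mul_of_pos_right _ (by omega)
        _ = (r + 1) * r.choose X := (Nat.add_one_mul_choose_eq r X).symm
        _ ≤ _ := Nat.mul_le_mul_right _ hr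
    exact_mod_cast h3
  have hp : (0 : ℝ) < (b : ℝ) ^ (r + 1) := by positivity
  have h4 := mul_le_mul_of_nonneg_left hc hp.le
  have h5 : (b : ℝ) ^ (r + 1) * truncSum b (r + 1) X - (b : ℝ) ^ X * ((b : ℝ) - 1) ^ (r + 1) ≤
      (b : ℝ) ^ (r + 1) * (r.choose X : ℝ) := by
    refine le_of_mul_le_mul_left (h2.trans (h4.trans_eq ?_)) hb0
    ring
  linarith

lemma pow_mul_truncCount_le_of_odd {b r : ℕ} (hb : 1 ≤ b) (hr : r + 1 ≤ b) {X : ℕ}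
    (hX : Odd X) :
    (b : ℝ) ^ (r + 1) * truncCount b (r + 1) X ≤
      (b : ℝ) ^ X * ((b : ℝ) - 1) ^ (r + 1) + (b : ℝ) ^ (r + 1) * (r.choose X : ℝ) := by
  have h1 := (truncSum_bounds hb hr X).1
  rw [truncCount_eq, hX.neg_one_pow]
  rw [hX.neg_one_pow] at h1
  linarith

lemma truncCount_one (b : ℝ) (r : ℕ) : truncCount b r 1 = b - 1 := by
  simp [truncCount, sum_range_succ]

/-! ### Excesses and the total share received by one set -/

/-- The excess over `1` of the function `g` at an odd argument `2 i + (2 u - 1)`, `r = j - i`. -/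
def excess (b r u : ℕ) : ℝ :=
  if u = 0 then 0 else if u = 1 then ((b : ℝ) / ((b : ℝ) - 1)) ^ (r - 1) - 1
  else (b : ℝ) ^ (r + 1) / ((b : ℝ) ^ (2 * u) * ((b : ℝ) - 1) ^ r) *
    ((r - 1).choose (2 * u - 1) : ℝ)

lemma one_le_cast_sub_one {b : ℕ} (hb : 2 ≤ b) : (1 : ℝ) ≤ (b : ℝ) - 1 := by
  have : (2 : ℝ) ≤ b := by exact_mod_cast hb
  linarith

lemma excess_nonneg {b : ℕ} (hb : 2 ≤ b) (r u : ℕ) : 0 ≤ excess b r u := by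
  have h1 := one_le_cast_sub_one hb
  unfold excess
  split_ifs
  · exact le_rfl
  · have : 1 ≤ (b : ℝ) / ((b : ℝ) - 1) := by rw [le_div_iff₀ (by linarith)]; linarith
    linarith [one_le_pow₀ this (n := r - 1)]
  · have : 0 ≤ (b : ℝ) - 1 := by linarith
    positivity

lemma excess_eq_zero {b r u : ℕ} (hr : r < 2 * u) : excess b r u = 0 := by
  unfold excess
  split_ifs with h0 h1
  · rfl
  · rw [show r - 1 = 0 by omega]; simp
  · rw [Nat.choose_eq_zero_of_lt (by omega)]; simp

/-- The share of excess received by a set of size `z` with `w` elements in its complement from its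
subsets of codimension `u`. -/
def share (b w z u : ℕ) : ℝ :=
  (z.choose u : ℝ) * (excess b (w + u) u / ((w + u).choose u : ℝ))

lemma share_nonneg {b : ℕ} (hb : 2 ≤ b) (w z u : ℕ) : 0 ≤ share b w z u := by
  have := excess_nonneg hb (w + u) u
  unfold share; positivity

lemma share_zero (b w z : ℕ) : share b w z 0 = 0 := by simp [share, excess]

lemma share_one (b w z : ℕ) :
    share b w z 1 = z * (((b : ℝ) / ((b : ℝ) - 1)) ^ w - 1) / (w + 1) := by
  simp [share, excess, mul_div_assoc]

lemma share_of_two_le {b u : ℕ} (hb : 2 ≤ b) (hu : 2 ≤ u) (w z : ℕ) :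
    share b w z u = ((b : ℝ) / ((b : ℝ) - 1)) ^ w * b / ((b : ℝ) * ((b : ℝ) - 1)) ^ u *
      ((z.choose u : ℝ) * ((w + u - 1).choose (2 * u - 1) : ℝ) / ((w + u).choose u : ℝ)) := by
  have h1 := one_le_cast_sub_one hb
  have h2 : (b : ℝ) - 1 ≠ 0 := by linarith
  have h3 : (b : ℝ) ≠ 0 := by linarith
  have h4 : ((w + u).choose u : ℝ) ≠ 0 := by
    exact_mod_cast (Nat.choose_pos (by omega)).ne'
  rw [share, excess, if_neg (by omega), if_neg (by omega)]
  rw [div_pow, mul_pow, two_mul, pow_add, pow_add, pow_add, pow_add]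
  field_simp

lemma choose_ratio_succ (w z u : ℕ) :
    (((z.choose (u + 3) : ℕ) : ℝ) * ((w + (u + 3) - 1).choose (2 * (u + 3) - 1) : ℝ) /
      ((w + (u + 3)).choose (u + 3) : ℝ)) ≤ (z * w : ℝ) / 2 *
    (((z.choose (u + 2) : ℕ) : ℝ) * ((w + (u + 2) - 1).choose (2 * (u + 2) - 1) : ℝ) /
      ((w + (u + 2)).choose (u + 2) : ℝ)) := by
  have e1 : ((z.choose (u + 3) : ℕ) : ℝ) * (u + 3) ≤ (z.choose (u + 2) : ℝ) * z := by
    have := Nat.choose_succ_right_eq z (u + 2)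
    have h : z.choose (u + 3) * (u + 3) ≤ z.choose (u + 2) * z := by
      rw [this]; exact Nat.mul_le_mul_left _ (by omega)
    exact_mod_cast h
  have e2 : ((w + u + 2).choose (2 * u + 5) : ℝ) * (2 * u + 5) * (2 * u + 4) ≤
      w * ((w + u + 2) * ((w + u + 1).choose (2 * u + 3) : ℝ)) := by
    have h1 := Nat.choose_succ_right_eq (w + u + 2) (2 * u + 4)
    have h2 := Nat.add_one_mul_choose_eq (w + u + 1) (2 * u + 3)
    have h : (w + u + 2).choose (2 * u + 5) * (2 * u + 5) * (2 * u + 4) ≤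
        w * ((w + u + 2) * (w + u + 1).choose (2 * u + 3)) := by
      rw [h1, show w + u + 2 = w + u + 1 + 1 by ring, h2]
      calc _ = (w + u + 1 + 1 - (2 * u + 4)) *
            ((w + u + 1 + 1).choose (2 * u + 3 + 1) * (2 * u + 3 + 1)) := by ring
        _ ≤ _ := Nat.mul_le_mul_right _ (by omega)
    exact_mod_cast h
  have e3 : ((w + u + 3).choose (u + 3) : ℝ) * (u + 3) =
      (w + u + 3) * ((w + u + 2).choose (u + 2) : ℝ) := by
    exact_mod_cast (Nat.add_one_mul_choose_eq (w + u + 2) (u + 2)).symm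
  rw [show w + (u + 3) - 1 = w + u + 2 by omega, show 2 * (u + 3) - 1 = 2 * u + 5 by omega,
    show w + (u + 2) - 1 = w + u + 1 by omega, show 2 * (u + 2) - 1 = 2 * u + 3 by omega,
    show w + (u + 3) = w + u + 3 by ring, show w + (u + 2) = w + u + 2 by ring]
  have p1 : (0 : ℝ) < ((w + u + 2).choose (u + 2) : ℝ) := by
    exact_mod_cast Nat.choose_pos (by omega)
  have p2 : (0 : ℝ) < ((w + u + 3).choose (u + 3) : ℝ) := by
    exact_mod_cast Nat.choose_pos (by omega)
  have n1 : (0 : ℝ) ≤ (z.choose (u + 3) : ℝ) := by positivity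
  have n2 : (0 : ℝ) ≤ (z.choose (u + 2) : ℝ) := by positivity
  have n3 : (0 : ℝ) ≤ ((w + u + 2).choose (2 * u + 5) : ℝ) := by positivity
  have n4 : (0 : ℝ) ≤ ((w + u + 1).choose (2 * u + 3) : ℝ) := by positivity
  generalize ((w + u + 2).choose (u + 2) : ℝ) = c at *
  generalize ((w + u + 3).choose (u + 3) : ℝ) = c' at *
  generalize (z.choose (u + 3) : ℝ) = a' at *
  generalize (z.choose (u + 2) : ℝ) = a at *
  generalize ((w + u + 2).choose (2 * u + 5) : ℝ) = d' at *
  generalize ((w + u + 1).choose (2 * u + 3) : ℝ) = d at *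
  have hu : (0 : ℝ) ≤ u := by positivity
  have hw : (0 : ℝ) ≤ w := by positivity
  have hz : (0 : ℝ) ≤ z := by positivity
  generalize (u : ℝ) = u at *
  generalize (w : ℝ) = w at *
  generalize (z : ℝ) = z at *
  -- The factor (2u+5)(2u+4) is replaced crudely by 2; a ratio of one half is enough for the
  -- geometric decay of the shares.
  have e4 : d' * 2 ≤ w * d * (w + u + 3) := by
    have h1 : d' * 2 ≤ d' * (2 * u + 5) * (2 * u + 4) := by
      rw [mul_assoc]
      exact mul_le_mul_of_nonneg_left (by nlinarith) n3
    have h2 : 0 ≤ w * d := by positivity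
    linarith
  rw [← mul_div_assoc, div_le_div_iff₀ p2 p1]
  refine le_of_mul_le_mul_right ?_ (by positivity : 0 < u + 3)
  have s1 : a' * (u + 3) * (d' * c) ≤ a * z * (d' * c) :=
    mul_le_mul_of_nonneg_right e1 (by positivity)
  have s2 : d' * 2 * (a * z * c) ≤ w * d * (w + u + 3) * (a * z * c) :=
    mul_le_mul_of_nonneg_right e4 (by positivity)
  have s3 : z * w / 2 * (a * d) * c' * (u + 3) = z * w / 2 * (a * d) * ((w + u + 3) * c) := by
    rw [mul_assoc, e3]
  rw [s3]
  linarith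

lemma share_succ_le {b w z : ℕ} (hb : 2 ≤ b) (hw : 1 ≤ w) (hzw : z + w ≤ b) (u : ℕ) :
    share b w z (u + 3) ≤ share b w z (u + 2) / 2 := by
  have h1 := one_le_cast_sub_one hb
  rw [share_of_two_le hb (by omega), share_of_two_le hb (by omega)]
  have hz' : (z : ℝ) ≤ (b : ℝ) - 1 := by
    have : (z : ℝ) + 1 ≤ b := by exact_mod_cast (by omega : z + 1 ≤ b)
    linarith
  have hw' : (w : ℝ) ≤ b := by exact_mod_cast (by omega : w ≤ b)
  have hq : (z : ℝ) * w ≤ b * (b - 1) := by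
    rw [mul_comm (b : ℝ)]
    exact mul_le_mul hz' hw' (by positivity) (by linarith)
  have hc := choose_ratio_succ w z u
  have hpos : (0 : ℝ) < b * (b - 1) := by apply mul_pos <;> linarith
  have hy : 0 ≤ ((b : ℝ) / ((b : ℝ) - 1)) ^ w * b := by
    have : 0 ≤ (b : ℝ) - 1 := by linarith
    positivity
  set A := ((z.choose (u + 3) : ℕ) : ℝ) * ((w + (u + 3) - 1).choose (2 * (u + 3) - 1) : ℝ) /
      ((w + (u + 3)).choose (u + 3) : ℝ)
  set A' := ((z.choose (u + 2) : ℕ) : ℝ) * ((w + (u + 2) - 1).choose (2 * (u + 2) - 1) : ℝ) /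
      ((w + (u + 2)).choose (u + 2) : ℝ)
  have hA' : 0 ≤ A' := by positivity
  generalize ((b : ℝ) / ((b : ℝ) - 1)) ^ w * b = Y at *
  generalize (b : ℝ) * (b - 1) = Q at *
  have hle : A ≤ Q / 2 * A' := hc.trans (mul_le_mul_of_nonneg_right (by linarith) hA')
  calc Y / Q ^ (u + 3) * A ≤ Y / Q ^ (u + 3) * (Q / 2 * A') :=
        mul_le_mul_of_nonneg_left hle (by positivity)
    _ = _ := by rw [pow_succ Q (u + 2)]; field_simp

/-- Geometric series of ratio 1/2; the subtracted last term is what makes the induction close. -/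
lemma sum_share_le {b w z : ℕ} (hb : 2 ≤ b) (hw : 1 ≤ w) (hzw : z + w ≤ b) (n : ℕ) :
    ∑ u ∈ range n, share b w z (u + 2) ≤ 2 * share b w z 2 - 2 * share b w z (n + 2) := by
  induction n with
  | zero => simp
  | succ n ih =>
    rw [sum_range_succ, show n + 1 + 2 = n + 3 by ring]
    linarith [share_succ_le hb hw hzw n]

lemma share_two {b : ℕ} (hb : 2 ≤ b) (w z : ℕ) :
    share b w z 2 = ((b : ℝ) / ((b : ℝ) - 1)) ^ w * b / ((b : ℝ) * ((b : ℝ) - 1)) ^ 2 *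
      (z * (z - 1) * w * (w - 1) / (6 * (w + 2))) := by
  rw [share_of_two_le hb le_rfl]
  congr 1
  have h3 : ((w + 1).choose 3 : ℝ) * 6 = (w + 1) * w * (w - 1) := by
    have h1 := Nat.choose_succ_right_eq (w + 1) 2
    have h2 : ((w + 1).choose 3 : ℝ) * 3 = ((w + 1).choose 2 : ℝ) * (w - 1) := by
      rcases w with _ | w
      · simp [Nat.choose]
      · have h : (w + 2).choose 3 * 3 = (w + 2).choose 2 * w := by simpa using h1
        push_cast
        rw [add_sub_cancel_right]
        exact_mod_cast h
    have h4 := Nat.cast_choose_two ℝ (w + 1)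
    push_cast at h4
    rw [h4] at h2
    linarith
  rw [show w + 2 - 1 = w + 1 by omega, show 2 * 2 - 1 = 3 by norm_num, Nat.cast_choose_two,
    Nat.cast_choose_two, show ((w + 1).choose 3 : ℝ) = (w + 1) * w * (w - 1) / 6 by linarith]
  push_cast
  have : (w : ℝ) + 2 - 1 ≠ 0 := by
    rw [add_sub_assoc]; norm_num; positivity
  field_simp
  ring

/-- A lower bound for (1 - 1/b)^w by a truncated binomial expansion, with 1/3 in place of 1/2 in the
quadratic term. Each induction step gains b^w (w/3)(b - w + 1) ≥ 0. -/
lemma pow_mul_quadratic_le {b w : ℕ} (hw : w ≤ b) (hb : 1 ≤ b) :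
    (b : ℝ) ^ w * ((b : ℝ) ^ 2 - w * b + w * (w - 1) / 3) ≤ (b : ℝ) ^ 2 * ((b : ℝ) - 1) ^ w := by
  induction w with
  | zero => simp
  | succ w ih =>
    have hb1 : (0 : ℝ) ≤ (b : ℝ) - 1 := by
      have : (1 : ℝ) ≤ b := by exact_mod_cast hb
      linarith
    have hwb : (w : ℝ) + 1 ≤ b := by exact_mod_cast hw
    have h1 := mul_le_mul_of_nonneg_right (ih (by omega)) hb1
    have h2 : 0 ≤ (b : ℝ) ^ w * (w / 3 * (b - w + 1)) := by
      have : 0 ≤ (b : ℝ) - w + 1 := by linarith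
      positivity
    rw [pow_succ, pow_succ ((b : ℝ) - 1)]
    push_cast
    linarith

/-- By geometric decay only share 1 plus twice share 2 matters. With c = w(w-1)/3 these are at most
(w - c/b)/(w+1) and (c/b)/(w+1), so c cancels and w/(w+1) remains. -/
lemma sum_share_le_one {b w z : ℕ} (hb : 2 ≤ b) (hw : 1 ≤ w) (hzw : z + w ≤ b) :
    ∑ u ∈ range (z + 1), share b w z u ≤ 1 := by
  rcases Nat.eq_zero_or_pos z with rfl | hz
  · simp [share_zero]
  obtain ⟨n, rfl⟩ : ∃ n, z = n + 1 := ⟨z - 1, by omega⟩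
  set z := n + 1
  rw [sum_range_succ', sum_range_succ', share_zero, add_zero]
  refine (add_le_add_left (sum_share_le hb hw hzw n) _).trans ?_
  have hn := share_nonneg hb w z (n + 2)
  suffices hs : share b w z 1 + 2 * share b w z 2 ≤ 1 by
    simp only [zero_add]; linarith
  rw [share_one, share_two hb]
  have h1 := one_le_cast_sub_one hb
  have hq := pow_mul_quadratic_le (by omega : w ≤ b) (by omega)
  have hw1 : (1 : ℝ) ≤ w := by exact_mod_cast hw
  have hz1 : (1 : ℝ) ≤ z := by exact_mod_cast hz
  have hzv : (z : ℝ) ≤ b - w := by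
    have : (z : ℝ) + w ≤ b := by exact_mod_cast hzw
    linarith
  have hy1 : 1 ≤ ((b : ℝ) / ((b : ℝ) - 1)) ^ w :=
    one_le_pow₀ (by rw [le_div_iff₀ (by linarith)]; linarith)
  have hyp : ((b : ℝ) / ((b : ℝ) - 1)) ^ w * ((b : ℝ) ^ 2 - w * b + w * (w - 1) / 3) ≤
      (b : ℝ) ^ 2 := by
    rw [div_pow, div_mul_eq_mul_div, div_le_iff₀ (by positivity)]
    exact hq
  generalize ((b : ℝ) / ((b : ℝ) - 1)) ^ w = y at *
  generalize (w : ℝ) = w at *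
  generalize (z : ℝ) = z at *
  generalize (b : ℝ) = b at *
  obtain ⟨c, hc⟩ : ∃ c, c = w * (w - 1) / 3 := ⟨_, rfl⟩
  have hc0 : 0 ≤ c := by
    have : 0 ≤ w - 1 := by linarith
    rw [hc]; positivity
  have hb0 : 0 < b := by linarith
  have hvb : (b - w) * y ≤ b - c / b := by
    have e1 : b * ((b - w) * y) + y * c ≤ b ^ 2 := by rw [hc]; linarith
    have e2 : c ≤ y * c := le_mul_of_one_le_left hc0 hy1
    rw [le_sub_iff_add_le, ← mul_le_mul_iff_right₀ hb0, mul_add, mul_div_cancel₀ _ hb0.ne']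
    nlinarith
  have f1 : z * (y - 1) / (w + 1) ≤ (w - c / b) / (w + 1) := by
    gcongr
    have : z * (y - 1) ≤ (b - w) * (y - 1) := mul_le_mul_of_nonneg_right hzv (by linarith)
    linarith
  have f2 : 2 * (y * b / (b * (b - 1)) ^ 2 * (z * (z - 1) * w * (w - 1) / (6 * (w + 2)))) ≤
      (c / b) / (w + 1) := by
    have k1 : z * (z - 1) * y ≤ b * (b - w - 1) := by
      have : z * y ≤ b := by
        have : z * y ≤ (b - w) * y := mul_le_mul_of_nonneg_right hzv (by linarith)
        have : 0 ≤ c / b := by positivity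
        linarith
      calc z * (z - 1) * y = z * y * (z - 1) := by ring
        _ ≤ b * (b - w - 1) := mul_le_mul this (by linarith) (by linarith) hb0.le
    -- Since w ≥ 1, b(b - w - 1) ≤ b(b - 2) ≤ (b - 1)^2.
    have k2 : b * (b - w - 1) * (w + 1) ≤ (b - 1) ^ 2 * (w + 2) :=
      mul_le_mul (by nlinarith) (by linarith) (by linarith) (by positivity)
    have k3 : z * (z - 1) * y * (w + 1) ≤ (b - 1) ^ 2 * (w + 2) :=
      (mul_le_mul_of_nonneg_right k1 (by linarith)).trans k2
    have hb1 : 0 < b - 1 := by linarith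
    have lhs : 2 * (y * b / (b * (b - 1)) ^ 2 * (z * (z - 1) * w * (w - 1) / (6 * (w + 2)))) =
        c * (z * (z - 1) * y) / (b * ((b - 1) ^ 2 * (w + 2))) := by
      rw [hc]; field_simp; ring
    rw [lhs, div_div, div_le_div_iff₀ (by positivity) (by positivity)]
    calc c * (z * (z - 1) * y) * (b * (w + 1)) = c * b * (z * (z - 1) * y * (w + 1)) := by ring
      _ ≤ c * b * ((b - 1) ^ 2 * (w + 2)) := mul_le_mul_of_nonneg_left k3 (by positivity)
      _ = _ := by ring
  have : (w - c / b) / (w + 1) + (c / b) / (w + 1) ≤ 1 := by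
    rw [← add_div, sub_add_cancel, div_le_one (by linarith)]; linarith
  linarith

/-! ### The bound on G by redistributing excess -/

section

lemma g_le_one_add_excess {b j i : ℕ} (hb : 2 ≤ b) (hij : i < j) (x : ℤ) :
    g b j i (x + 2 * i) ≤
      if 0 < x then 1 + (if Odd x then excess b (j - i) ((x + 1) / 2).toNat else 0) else 0 := by
  have h0 : 0 ≤ if Odd x then excess b (j - i) ((x + 1) / 2).toNat else 0 := by
    split_ifs
    · exact excess_nonneg hb _ _
    · exact le_rfl
  by_cases hx : 0 < x
  swap
  · rw [g, if_pos (by omega), if_neg hx]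
  rw [if_pos hx, g, if_neg (by omega)]
  split_ifs with h1 h2 h3 h3
  · linarith [excess_nonneg hb (j - i) ((x + 1) / 2).toNat]
  · simp
  · have : ((x + 1) / 2).toNat = 1 := by omega
    rw [this]
    simp [excess]
  · exact absurd (by rw [show x = 1 by omega]; exact odd_one) h3
  · obtain ⟨u, hu⟩ := ‹Odd x›
    obtain ⟨v, rfl⟩ : ∃ v : ℕ, u = v := ⟨u.toNat, by omega⟩
    have hv : ((x + 1) / 2).toNat = v + 1 := by omega
    have h4 : ((x + 2 * i) - 2 * i).toNat = 2 * (v + 1) - 1 := by omega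
    have h1' := one_le_cast_sub_one hb
    have hb0 : (b : ℝ) ≠ 0 := by linarith
    have hz : (b : ℝ) ^ ((j : ℤ) + i - (x + 2 * i)) =
        (b : ℝ) ^ (j - i + 1) / (b : ℝ) ^ (2 * (v + 1)) := by
      rw [← zpow_natCast, ← zpow_natCast, ← zpow_sub₀ hb0]
      congr 1
      push_cast [hij.le]
      omega
    rw [hv, h, h4, excess, if_neg (by omega), if_neg (by omega), hz, div_div]
  · rename_i h5
    exfalso
    apply h1
    right
    rw [Int.not_odd_iff_even] at h5
    exact h5.add (even_two_mul _)

variable {α : Type*} [DecidableEq α]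

/-- Double counting: the excess of each I is split equally among its extensions by u elements, where
X(I) = 2u - 1, and the sums are then exchanged so that each receiving Z is bounded separately. -/
lemma sum_excess_le {b : ℕ} (hb : 2 ≤ b) {J : Finset α} (hJ : #J ≤ b) (X : Finset α → ℤ)
    (hX : ∀ I Z, I ⊆ Z → Z ⊆ J → X Z + 2 * #Z ≤ X I + 2 * #I) :
    ∑ I ∈ J.ssubsets with 0 < X I,
      (if Odd (X I) then excess b (#J - #I) ((X I + 1) / 2).toNat else 0) ≤
      (#{Z ∈ J.ssubsets | ¬ 0 < X Z} : ℝ) := by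
  let c : Finset α → Finset α → ℝ := fun I Z =>
    if I ⊆ Z ∧ X I = 2 * ((#Z : ℤ) - #I) - 1 then
      excess b (#J - #I) (#Z - #I) / ((#J - #I).choose (#Z - #I) : ℝ) else 0
  have hc0 : ∀ I Z, 0 ≤ c I Z := by
    intro I Z
    simp only [c]
    split_ifs
    · have := excess_nonneg hb (#J - #I) (#Z - #I)
      positivity
    · exact le_rfl
  have spread : ∀ I ∈ J.ssubsets.filter (fun I => 0 < X I),
      (if Odd (X I) then excess b (#J - #I) ((X I + 1) / 2).toNat else 0) ≤
      ∑ Z ∈ J.ssubsets with ¬ 0 < X Z, c I Z := by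
    intro I hI
    obtain ⟨hIJ, hI0⟩ := mem_filter.1 hI
    rw [mem_ssubsets] at hIJ
    have hnn : 0 ≤ ∑ Z ∈ J.ssubsets with ¬ 0 < X Z, c I Z := sum_nonneg fun Z _ => hc0 I Z
    split_ifs with hodd
    swap
    · exact hnn
    obtain ⟨u', hu'⟩ := hodd
    obtain ⟨u, hu⟩ : ∃ u : ℕ, X I = 2 * u - 1 := ⟨(u' + 1).toNat, by omega⟩
    have hu1 : ((X I + 1) / 2).toNat = u := by omega
    rw [hu1]
    -- If |J| - |I| < 2u there is nothing to distribute; otherwise 1 ≤ u < |J| - |I|, so u-element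
    -- extensions exist and are proper subsets of J.
    by_cases hr : #J - #I < 2 * u
    · rw [excess_eq_zero hr]; exact hnn
    have hcard : #(J \ I) = #J - #I := card_sdiff_of_subset hIJ.subset
    have hcu : ∀ T ∈ powersetCard u (J \ I), I ∪ T ⊆ J ∧ #(I ∪ T) = #I + u := by
      intro T hT
      obtain ⟨hT1, hT2⟩ := mem_powersetCard.1 hT
      refine ⟨union_subset hIJ.subset (hT1.trans sdiff_subset), ?_⟩
      rw [card_union_of_disjoint, hT2]
      exact disjoint_of_subset_right hT1 disjoint_sdiff
    have hch : ((#J - #I).choose u : ℝ) ≠ 0 := by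
      exact_mod_cast (Nat.choose_pos (by omega)).ne'
    calc excess b (#J - #I) u
        = ∑ T ∈ powersetCard u (J \ I), excess b (#J - #I) u / ((#J - #I).choose u : ℝ) := by
          rw [sum_const, card_powersetCard, hcard, nsmul_eq_mul]; field_simp
      _ = ∑ T ∈ powersetCard u (J \ I), c I (I ∪ T) := by
          refine sum_congr rfl fun T hT => ?_
          have h2 := (hcu T hT).2
          simp only [c]
          rw [if_pos ⟨subset_union_left, by rw [h2, hu]; push_cast; ring⟩, h2,
            Nat.add_sub_cancel_left]
      _ = ∑ Z ∈ (powersetCard u (J \ I)).image (I ∪ ·), c I Z := by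
          rw [sum_image]
          intro T hT T' hT' hTT
          have d1 := (mem_powersetCard.1 hT).1
          have d2 := (mem_powersetCard.1 hT').1
          have e : ∀ T, T ⊆ J \ I → (I ∪ T) \ I = T := fun T h =>
            union_sdiff_cancel_left (disjoint_of_subset_right h disjoint_sdiff)
          rw [← e T d1, ← e T' d2]
          exact congrArg (· \ I) hTT
      _ ≤ _ := by
          refine sum_le_sum_of_subset_of_nonneg ?_ fun Z _ _ => hc0 I Z
          intro Z hZ
          obtain ⟨T, hT, rfl⟩ := mem_image.1 hZ
          obtain ⟨h1, h2⟩ := hcu T hT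
          -- Gives X(I ∪ T) ≤ X(I) - 2u = -1, so the receiving set has a zero summand.
          have h3 := hX I (I ∪ T) subset_union_left h1
          rw [mem_filter, mem_ssubsets]
          refine ⟨ssubset_of_subset_of_ne h1 fun h => ?_, ?_⟩
          · have := congrArg card h
            omega
          · rw [h2, hu] at h3; push_cast at h3; omega
  refine (sum_le_sum spread).trans ?_
  rw [sum_comm, card_eq_sum_ones, Nat.cast_sum]
  refine sum_le_sum fun Z hZ => ?_
  obtain ⟨hZJ, hZ0⟩ := mem_filter.1 hZ
  rw [mem_ssubsets] at hZJ
  have hlt := card_lt_card hZJ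
  let f : ℕ → ℝ := fun i => excess b (#J - i) (#Z - i) / ((#J - i).choose (#Z - i) : ℝ)
  have hf0 : ∀ i, 0 ≤ f i := fun i => by
    have := excess_nonneg hb (#J - i) (#Z - i)
    simp only [f]; positivity
  calc ∑ I ∈ J.ssubsets with 0 < X I, c I Z ≤ ∑ I ∈ J.ssubsets with 0 < X I,
        (if I ∈ Z.powerset then f #I else 0) := by
        refine sum_le_sum fun I _ => ?_
        simp only [c, mem_powerset]
        split_ifs with h1 h2 h2
        · exact le_rfl
        · exact absurd h1.1 h2
        · exact hf0 _
        · exact le_rfl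
    _ ≤ ∑ I ∈ Z.powerset, f #I := by
        rw [← sum_filter]
        refine sum_le_sum_of_subset_of_nonneg ?_ fun I _ _ => hf0 _
        intro I hI
        exact (mem_filter.1 hI).2
    _ = ∑ i ∈ range (#Z + 1), (#Z).choose i • f i := sum_powerset_apply_card f
    _ = ∑ u ∈ range (#Z + 1), share b (#J - #Z) (#Z) u := by
        -- Reindexing from the size of I to its codimension u in Z.
        rw [← sum_range_reflect]
        refine sum_congr rfl fun u hu => ?_
        have hu' : u ≤ #Z := by have := mem_range.1 hu; omega
        simp only [f, share, nsmul_eq_mul]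
        rw [show #Z + 1 - 1 - u = #Z - u by omega, Nat.choose_symm hu',
          show #J - (#Z - u) = #J - #Z + u by omega, show #Z - (#Z - u) = u by omega]
    -- Here w = |J| - |Z| ≥ 1 because Z is proper, and z + w = |J| ≤ b.
    _ ≤ 1 := sum_share_le_one hb (by omega) (by omega)
    _ = _ := by simp

lemma sum_g_le {b : ℕ} (hb : 2 ≤ b) {J : Finset α} (hJ : #J ≤ b) (X : Finset α → ℤ)
    (hX : ∀ I Z, I ⊆ Z → Z ⊆ J → X Z + 2 * #Z ≤ X I + 2 * #I) :
    ∑ I ∈ J.ssubsets, g b #J #I (X I + 2 * #I) ≤ 2 ^ #J - 1 := by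
  have hcard : (#J.ssubsets : ℝ) = 2 ^ #J - 1 := by
    rw [ssubsets, card_erase_of_mem (mem_powerset_self J), card_powerset,
      Nat.cast_sub Nat.one_le_two_pow]
    simp
  calc _ ≤ ∑ I ∈ J.ssubsets, (if 0 < X I then
        1 + (if Odd (X I) then excess b (#J - #I) ((X I + 1) / 2).toNat else 0) else 0) :=
        sum_le_sum fun I hI =>
          g_le_one_add_excess hb (card_lt_card (mem_ssubsets.1 hI)) (X I)
    _ = #{I ∈ J.ssubsets | 0 < X I} + ∑ I ∈ J.ssubsets with 0 < X I,
        (if Odd (X I) then excess b (#J - #I) ((X I + 1) / 2).toNat else 0) := by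
        rw [← sum_filter, sum_add_distrib]; simp
    _ ≤ #{I ∈ J.ssubsets | 0 < X I} + #{Z ∈ J.ssubsets | ¬ 0 < X Z} :=
        add_le_add_right (sum_excess_le hb hJ X hX) _
    _ = 2 ^ #J - 1 := by
        rw [← hcard, ← Nat.cast_add, card_filter_add_card_filter_not]

lemma G_eq (b m s : ℕ) (J : Finset (Fin s)) (k : Fin s → ℕ) :
    G b m s J k 0 = ∑ I ∈ J.ssubsets, g b #J #I
      (((m : ℤ) - ((∑ j ∈ I ∪ Jᶜ, k j : ℕ) : ℤ) - 2 * #I) + 2 * #I) := by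
  simp [G]

lemma G_le {b m s : ℕ} (hb : 2 ≤ b) (hsb : s ≤ b) (J : Finset (Fin s)) (k : Fin s → ℕ) :
    G b m s J k 0 ≤ 2 ^ #J - 1 := by
  rw [G_eq]
  refine sum_g_le hb ((card_le_univ J).trans (by simpa using hsb))
    (fun I => (m : ℤ) - ((∑ j ∈ I ∪ Jᶜ, k j : ℕ) : ℤ) - 2 * #I) fun I Z hIZ _ => ?_
  have : ∑ j ∈ I ∪ Jᶜ, k j ≤ ∑ j ∈ Z ∪ Jᶜ, k j :=
    sum_le_sum_of_subset (union_subset_union_left hIZ)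
  omega

end

/-! ### Digits, elementary boxes and counting numbers of nets -/

section

lemma floor_pow_mul_div (b q t : ℕ) (hb : 1 ≤ b) (x : ℝ) :
    ⌊(b : ℝ) ^ (q + t) * x⌋₊ / b ^ t = ⌊(b : ℝ) ^ q * x⌋₊ := by
  have hb0 : (b : ℝ) ≠ 0 := by positivity
  rw [← Nat.floor_div_natCast]
  congr 1
  push_cast
  rw [pow_add]
  field_simp

lemma floor_pow_mul_eq_of_le {b q q' : ℕ} (hb : 1 ≤ b) (hq : q ≤ q') {x y : ℝ}
    (h : ⌊(b : ℝ) ^ q' * x⌋₊ = ⌊(b : ℝ) ^ q' * y⌋₊) :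
    ⌊(b : ℝ) ^ q * x⌋₊ = ⌊(b : ℝ) ^ q * y⌋₊ := by
  obtain ⟨t, rfl⟩ := Nat.exists_eq_add_of_le hq
  rw [← floor_pow_mul_div b q t hb, h, floor_pow_mul_div b q t hb]

lemma le_gam_iff {b : ℕ} (hb : 2 ≤ b) {x y : ℝ} (hx : x ∈ Set.Ico (0 : ℝ) 1)
    (hy : y ∈ Set.Ico (0 : ℝ) 1) (q : ℕ) :
    (q : ℕ∞) ≤ gam b x y ↔ ⌊(b : ℝ) ^ q * x⌋₊ = ⌊(b : ℝ) ^ q * y⌋₊ := by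
  unfold gam
  split_ifs with hxy
  · simp [hxy]
  have hfl : ∀ i : ℕ, ⌊(b : ℝ) ^ i * x⌋ = ⌊(b : ℝ) ^ i * y⌋ ↔
      ⌊(b : ℝ) ^ i * x⌋₊ = ⌊(b : ℝ) ^ i * y⌋₊ := by
    intro i
    have h1 : 0 ≤ (b : ℝ) ^ i * x := mul_nonneg (by positivity) hx.1
    have h2 : 0 ≤ (b : ℝ) ^ i * y := mul_nonneg (by positivity) hy.1
    rw [← Int.natCast_floor_eq_floor h1, ← Int.natCast_floor_eq_floor h2]
    exact_mod_cast Iff.rfl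
  simp only [ne_eq, hfl]
  have hne : {i : ℕ | ⌊(b : ℝ) ^ i * x⌋₊ = ⌊(b : ℝ) ^ i * y⌋₊ ∧
      ¬ ⌊(b : ℝ) ^ (i + 1) * x⌋₊ = ⌊(b : ℝ) ^ (i + 1) * y⌋₊}.Nonempty := by
    -- If no digit separated x from y, all floors would agree and |x - y| < b^(-N) for every N.
    -- Nonemptiness also keeps `sInf` from returning its default value.
    by_contra hemp
    rw [Set.not_nonempty_iff_eq_empty] at hemp
    have hall : ∀ i : ℕ, ⌊(b : ℝ) ^ i * x⌋₊ = ⌊(b : ℝ) ^ i * y⌋₊ := by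
      intro i
      induction i with
      | zero =>
        rw [Nat.floor_eq_zero.2 (by simpa using hx.2), Nat.floor_eq_zero.2 (by simpa using hy.2)]
      | succ i ih =>
        by_contra hcon
        exact (hemp ▸ (⟨ih, hcon⟩ : i ∈ {i : ℕ | _ ∧ _}) : i ∈ (∅ : Set ℕ))
    have hd : 0 < |x - y| := abs_pos.2 (sub_ne_zero.2 hxy)
    obtain ⟨N, hN⟩ := pow_unbounded_of_one_lt (|x - y|)⁻¹
      (by exact_mod_cast (by omega : 1 < b) : (1 : ℝ) < b)
    have h3 := Int.abs_sub_lt_one_of_floor_eq_floor ((hfl N).2 (hall N))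
    rw [← mul_sub, abs_mul, abs_of_nonneg (by positivity : (0 : ℝ) ≤ (b : ℝ) ^ N)] at h3
    rw [inv_lt_iff_one_lt_mul₀ hd] at hN
    linarith
  have hmem := Nat.sInf_mem hne
  set i := sInf {i : ℕ | ⌊(b : ℝ) ^ i * x⌋₊ = ⌊(b : ℝ) ^ i * y⌋₊ ∧
      ¬ ⌊(b : ℝ) ^ (i + 1) * x⌋₊ = ⌊(b : ℝ) ^ (i + 1) * y⌋₊}
  rw [Nat.cast_le]
  constructor
  · exact fun h => floor_pow_mul_eq_of_le (by omega) h hmem.1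
  · intro h
    by_contra hlt
    exact hmem.2 (floor_pow_mul_eq_of_le (by omega) (by omega) h)

lemma gam_eq_zero_iff {b : ℕ} (hb : 2 ≤ b) {x y : ℝ} (hx : x ∈ Set.Ico (0 : ℝ) 1)
    (hy : y ∈ Set.Ico (0 : ℝ) 1) :
    gam b x y = 0 ↔ ¬ ⌊(b : ℝ) ^ 1 * x⌋₊ = ⌊(b : ℝ) ^ 1 * y⌋₊ := by
  rw [← le_gam_iff hb hx hy 1, Nat.cast_one, Order.one_le_iff_ne_zero, not_not]

lemma mem_Ico_div_iff {b : ℕ} (hb : 1 ≤ b) (d a : ℕ) {x : ℝ} (hx : 0 ≤ x) :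
    x ∈ Set.Ico ((a : ℝ) / (b : ℝ) ^ d) (((a : ℝ) + 1) / (b : ℝ) ^ d) ↔
      ⌊(b : ℝ) ^ d * x⌋₊ = a := by
  have hp : (0 : ℝ) < (b : ℝ) ^ d := by positivity
  rw [Nat.floor_eq_iff (by positivity), Set.mem_Ico, div_le_iff₀ hp, lt_div_iff₀ hp, mul_comm x]

lemma floor_pow_mul_lt {b d : ℕ} (hb : 1 ≤ b) {x : ℝ} (hx : x ∈ Set.Ico (0 : ℝ) 1) :
    ⌊(b : ℝ) ^ d * x⌋₊ < b ^ d := by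
  have hp : (0 : ℝ) < (b : ℝ) ^ d := by positivity
  rw [Nat.floor_lt (mul_nonneg hp.le hx.1)]
  push_cast
  nlinarith [hx.2]

variable {b m s : ℕ} {P : Fin (b ^ m) → Fin s → ℝ}

lemma IsNet.card_box_eq_one (hP : IsNet b 0 m P) (hb : 1 ≤ b) {d a : Fin s → ℕ}
    (hd : ∑ j, d j = m) (ha : ∀ j, a j < b ^ d j) :
    #{l | ∀ j, ⌊(b : ℝ) ^ d j * P l j⌋₊ = a j} = 1 := by
  have h1 := hP.ncard_eq d a (by simpa using hd) ha
  simp only [mem_Ico_div_iff hb _ _ (hP.mem_unit _ _).1, pow_zero] at h1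
  rw [← h1, ← Set.ncard_coe_finset]
  simp

/-- The t unused digits are spent on one coordinate, cutting the box into b^t boxes of volume b^(-m)
with one point each; this needs a coordinate, hence 0 < s. -/
lemma IsNet.card_box (hP : IsNet b 0 m P) (hb : 1 ≤ b) (hs : 0 < s) {d a : Fin s → ℕ}
    (hd : ∑ j, d j ≤ m) (ha : ∀ j, a j < b ^ d j) :
    #{l | ∀ j, ⌊(b : ℝ) ^ d j * P l j⌋₊ = a j} = b ^ (m - ∑ j, d j) := by
  rcases hd.eq_or_lt with hd' | hd'
  · rw [hP.card_box_eq_one hb hd' ha, hd', Nat.sub_self, pow_zero]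
  obtain ⟨t, ht⟩ : ∃ t, m - ∑ j, d j = t := ⟨_, rfl⟩
  rw [ht]
  let j₀ : Fin s := ⟨0, hs⟩
  have hmaps : ∀ l ∈ ({l | ∀ j, ⌊(b : ℝ) ^ d j * P l j⌋₊ = a j} : Finset (Fin (b ^ m))),
      ⌊(b : ℝ) ^ (d j₀ + t) * P l j₀⌋₊ ∈ Ico (a j₀ * b ^ t) (a j₀ * b ^ t + b ^ t) := by
    intro l hl
    have h1 := (mem_filter.1 hl).2 j₀
    rw [← floor_pow_mul_div b _ t hb] at h1
    have hp : 0 < b ^ t := by positivity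
    rw [mem_Ico]
    have h2 := (Nat.div_eq_iff hp).1 h1
    omega
  rw [card_eq_sum_card_fiberwise hmaps]
  have hone : ∀ c ∈ Ico (a j₀ * b ^ t) (a j₀ * b ^ t + b ^ t),
      #{l ∈ ({l | ∀ j, ⌊(b : ℝ) ^ d j * P l j⌋₊ = a j} : Finset (Fin (b ^ m))) |
        ⌊(b : ℝ) ^ (d j₀ + t) * P l j₀⌋₊ = c} = 1 := by
    intro c hc
    rw [mem_Ico] at hc
    have hp : 0 < b ^ t := by positivity
    have hcdiv : c / b ^ t = a j₀ := by
      rw [Nat.div_eq_iff hp]; omega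
    have hsum : ∑ j, Function.update d j₀ (d j₀ + t) j = m := by
      rw [sum_update_of_mem (mem_univ _)]
      have := sum_eq_add_sum_sdiff_singleton_of_mem (mem_univ j₀) d
      omega
    rw [← hP.card_box_eq_one hb (a := Function.update a j₀ c) hsum, filter_filter]
    · congr 1
      ext l
      simp only [mem_filter, mem_univ, true_and]
      constructor
      · rintro ⟨h1, h2⟩ j
        by_cases hj : j = j₀
        · subst hj; simpa using h2
        · simpa [hj] using h1 j
      · intro h1
        have h2 := h1 j₀
        simp only [Function.update_self] at h2
        refine ⟨fun j => ?_, h2⟩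
        by_cases hj : j = j₀
        · subst hj
          rw [← floor_pow_mul_div b _ t hb, h2, hcdiv]
        · simpa [hj] using h1 j
    · intro j
      by_cases hj : j = j₀
      · subst hj
        simp only [Function.update_self]
        have := ha j₀
        rw [pow_add]
        nlinarith
      · simpa [hj] using ha j
  rw [sum_congr rfl hone]
  simp

lemma exists_le_sum_eq {s : ℕ} (d : Fin s → ℕ) {m : ℕ} (h : m ≤ ∑ j, d j) :
    ∃ d' : Fin s → ℕ, d' ≤ d ∧ ∑ j, d' j = m := by
  induction m with
  | zero => exact ⟨0, fun _ => Nat.zero_le _, by simp⟩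
  | succ m ih =>
    obtain ⟨d', h1, h2⟩ := ih (by omega)
    obtain ⟨j₀, -, hj⟩ : ∃ j ∈ univ, d' j < d j := exists_lt_of_sum_lt (by omega)
    refine ⟨Function.update d' j₀ (d' j₀ + 1), fun j => ?_, ?_⟩
    · by_cases hj' : j = j₀
      · subst hj'; simpa using hj
      · simpa [hj'] using h1 j
    · rw [sum_update_of_mem (mem_univ _)]
      have := sum_eq_add_sum_sdiff_singleton_of_mem (mem_univ j₀) d'
      omega

/-- The points other than `P i` that share `d j` digits with `P i` in every coordinate `j`. -/
def coMatches (b : ℕ) {n s : ℕ} (P : Fin n → Fin s → ℝ) (i : Fin n) (d : Fin s → ℕ) :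
    Finset (Fin n) :=
  {l | l ≠ i ∧ ∀ j, ⌊(b : ℝ) ^ d j * P l j⌋₊ = ⌊(b : ℝ) ^ d j * P i j⌋₊}

/-- If more than m digits are prescribed, relaxing to exactly m already leaves `P i` alone in its
box. -/
lemma IsNet.card_coMatches (hP : IsNet b 0 m P) (hb : 1 ≤ b) (hs : 0 < s)
    (i : Fin (b ^ m)) (d : Fin s → ℕ) :
    (#(coMatches b P i d) : ℝ) =
      if ∑ j, d j ≤ m then (b : ℝ) ^ (m - ∑ j, d j) - 1 else 0 := by
  have main : ∀ d : Fin s → ℕ, ∑ j, d j ≤ m →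
      (#(coMatches b P i d) : ℝ) = (b : ℝ) ^ (m - ∑ j, d j) - 1 := by
    intro d hd
    have h1 := hP.card_box hb hs (a := fun j => ⌊(b : ℝ) ^ d j * P i j⌋₊) hd
      fun j => floor_pow_mul_lt hb (hP.mem_unit i j)
    have h2 : coMatches b P i d = ({l | ∀ j, ⌊(b : ℝ) ^ d j * P l j⌋₊ =
        ⌊(b : ℝ) ^ d j * P i j⌋₊} : Finset (Fin (b ^ m))).erase i := by
      ext l; simp [coMatches]
    rw [h2, card_erase_of_mem (by simp), h1, Nat.cast_sub (Nat.one_le_pow _ _ hb)]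
    simp
  split_ifs with h
  · exact main d h
  obtain ⟨d', h1, h2⟩ := exists_le_sum_eq d (by omega : m ≤ ∑ j, d j)
  have h3 := main d' h2.le
  rw [h2, Nat.sub_self, pow_zero, sub_self, Nat.cast_eq_zero, card_eq_zero] at h3
  rw [Nat.cast_eq_zero, card_eq_zero, ← subset_empty, ← h3]
  intro l hl
  simp only [coMatches, mem_filter, mem_univ, true_and] at hl ⊢
  exact ⟨hl.1, fun j => floor_pow_mul_eq_of_le hb (h1 j) (hl.2 j)⟩

/-- The digit requirement `k j + 2` on `I`, `k j` off `J`, `1` on `K` and `0` elsewhere. -/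
def digitReq {s : ℕ} (k : Fin s → ℕ) (J I K : Finset (Fin s)) (j : Fin s) : ℕ :=
  (if j ∈ I ∪ Jᶜ then k j else 0) + ((if j ∈ I then 2 else 0) + if j ∈ K then 1 else 0)

lemma sum_digitReq {s : ℕ} (k : Fin s → ℕ) (J I K : Finset (Fin s)) :
    ∑ j, digitReq k J I K j = ∑ j ∈ I ∪ Jᶜ, k j + (2 * #I + #K) := by
  simp only [digitReq, sum_add_distrib]
  rw [sum_ite_mem, sum_ite_mem, sum_ite_mem]
  simp [mul_comm]

/-- The condition γ = 0 says that the first digits differ, so this is inclusion-exclusion over the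
coordinates of J \ I with the events "first digit agrees". -/
lemma countNum_eq (hP : IsNet b 0 m P) (hb : 2 ≤ b) (i : Fin (b ^ m)) (k : Fin s → ℕ)
    {J I : Finset (Fin s)} (hI : I ⊆ J) :
    (countNum b P k 0 2 J I i : ℝ) =
      ∑ K ∈ (J \ I).powerset, (-1 : ℝ) ^ #K * #(coMatches b P i (digitReq k J I K)) := by
  classical
  have hmem := hP.mem_unit
  let S : Fin s → Finset (Fin (b ^ m)) := fun j =>
    {l | ⌊(b : ℝ) ^ 1 * P l j⌋₊ = ⌊(b : ℝ) ^ 1 * P i j⌋₊}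
  have hinf := inclusion_exclusion_sum_inf_compl (G := ℤ) (J \ I) S
    (fun l => if l ∈ coMatches b P i (digitReq k J I ∅) then 1 else 0)
  have hK : ∀ K ∈ (J \ I).powerset,
      (∑ l ∈ K.inf S, if l ∈ coMatches b P i (digitReq k J I ∅) then (1 : ℤ) else 0) =
      #(coMatches b P i (digitReq k J I K)) := by
    intro K hK
    rw [mem_powerset] at hK
    rw [sum_boole]
    congr 2
    ext l
    simp only [mem_filter, mem_inf, S, coMatches, mem_univ, true_and]
    constructor
    · rintro ⟨h1, h2, h3⟩
      refine ⟨h2, fun j => ?_⟩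
      by_cases hj : j ∈ K
      · have hj' := mem_sdiff.1 (hK hj)
        simpa [digitReq, hj, hj'] using h1 j hj
      · simpa [digitReq, hj] using h3 j
    · rintro ⟨h1, h2⟩
      refine ⟨fun j hj => ?_, h1, fun j => ?_⟩
      · have hj' := mem_sdiff.1 (hK hj)
        simpa [digitReq, hj, hj'] using h2 j
      · refine floor_pow_mul_eq_of_le (by omega) ?_ (h2 j)
        simp [digitReq]
  have hL : (∑ l ∈ (J \ I).inf fun j => (S j)ᶜ,
      if l ∈ coMatches b P i (digitReq k J I ∅) then (1 : ℤ) else 0) =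
      countNum b P k 0 2 J I i := by
    rw [sum_boole, countNum, ← Set.ncard_coe_finset]
    congr 2
    ext l
    simp only [coe_filter, mem_inf, mem_compl, S, coMatches, mem_filter, mem_univ, true_and,
      Set.mem_ofPred_eq, Pi.zero_apply, Nat.cast_zero, le_gam_iff hb (hmem _ _) (hmem _ _),
      gam_eq_zero_iff hb (hmem _ _) (hmem _ _), add_zero]
    constructor
    · rintro ⟨h1, h2, h3⟩
      refine ⟨h2, fun j hj => ?_, fun j hj => ?_, fun j hj => fun h => h1 j hj h.symm⟩
      · simpa [digitReq, hj] using (h3 j).symm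
      · have hj' : j ∉ I := fun h => hj (hI h)
        simpa [digitReq, hj, hj'] using (h3 j).symm
    · rintro ⟨h1, h2, h3, h4⟩
      refine ⟨fun j hj => fun h => h4 j hj h.symm, h1, fun j => ?_⟩
      by_cases hj : j ∈ I
      · simpa [digitReq, hj] using (h2 j hj).symm
      · by_cases hj' : j ∈ J
        · have e0 : ∀ l, ⌊P l j⌋₊ = 0 := fun l => Nat.floor_eq_zero.2 (hmem l j).2
          simp [digitReq, hj, hj', e0]
        · simpa [digitReq, hj, hj'] using (h3 j hj').symm
  rw [hL, sum_congr rfl fun K hK' => by rw [hK K hK']] at hinf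
  have := congrArg (fun z : ℤ => (z : ℝ)) hinf
  simpa using this

lemma countNum_eq_sum_range (hP : IsNet b 0 m P) (hb : 2 ≤ b) (hs : 0 < s)
    (i : Fin (b ^ m)) (k : Fin s → ℕ)
    {J I : Finset (Fin s)} (hI : I ⊆ J) :
    (countNum b P k 0 2 J I i : ℝ) = ∑ q ∈ range (#J - #I + 1), (-1 : ℝ) ^ q *
      ((#J - #I).choose q : ℝ) * (if ∑ j ∈ I ∪ Jᶜ, k j + (2 * #I + q) ≤ m then
        (b : ℝ) ^ (m - (∑ j ∈ I ∪ Jᶜ, k j + (2 * #I + q))) - 1 else 0) := by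
  rw [countNum_eq hP hb i k hI, ← card_sdiff_of_subset hI]
  simp only [hP.card_coMatches (by omega : 1 ≤ b) hs, sum_digitReq]
  rw [sum_powerset_apply_card (fun q => (-1 : ℝ) ^ q *
    (if ∑ j ∈ I ∪ Jᶜ, k j + (2 * #I + q) ≤ m then
        (b : ℝ) ^ (m - (∑ j ∈ I ∪ Jᶜ, k j + (2 * #I + q))) - 1 else 0))]
  refine sum_congr rfl fun q _ => ?_
  rw [nsmul_eq_mul]; ring

lemma countNum_eq_zero (hP : IsNet b 0 m P) (hb : 2 ≤ b) (hs : 0 < s)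
    (i : Fin (b ^ m)) (k : Fin s → ℕ)
    {J I : Finset (Fin s)} (hI : I ⊆ J) (h : m ≤ ∑ j ∈ I ∪ Jᶜ, k j + 2 * #I) :
    (countNum b P k 0 2 J I i : ℝ) = 0 := by
  rw [countNum_eq_sum_range hP hb hs i k hI]
  refine sum_eq_zero fun q _ => ?_
  split_ifs with hq
  · rw [show m - (∑ j ∈ I ∪ Jᶜ, k j + (2 * #I + q)) = 0 by omega]; simp
  · simp

lemma countNum_eq_truncCount (hP : IsNet b 0 m P) (hb : 2 ≤ b) (hs : 0 < s)
    (i : Fin (b ^ m)) (k : Fin s → ℕ)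
    {J I : Finset (Fin s)} (hI : I ⊆ J) {X : ℕ} (h : ∑ j ∈ I ∪ Jᶜ, k j + 2 * #I + X = m) :
    (countNum b P k 0 2 J I i : ℝ) = truncCount b (#J - #I) X := by
  rw [countNum_eq_sum_range hP hb hs i k hI, truncCount]
  set r := #J - #I
  let f : ℕ → ℝ := fun q => (-1) ^ q * (r.choose q : ℝ) *
    if q ≤ X then (b : ℝ) ^ (X - q) - 1 else 0
  calc _ = ∑ q ∈ range (r + 1), f q := by
        refine sum_congr rfl fun q _ => ?_
        simp only [f]
        congr 1
        by_cases hq : q ≤ X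
        · rw [if_pos hq, if_pos (by omega)]; congr 2; omega
        · rw [if_neg hq, if_neg (by omega)]
    -- Both ranges embed in a common one: beyond r the binomial vanishes, beyond X the cutoff does.
    _ = ∑ q ∈ range (r + X + 1), f q := by
        refine sum_subset (range_mono (by omega)) fun q _ hq => ?_
        rw [mem_range] at hq
        simp only [f]
        rw [Nat.choose_eq_zero_of_lt (by omega)]; simp
    _ = ∑ q ∈ range (X + 1), f q := by
        refine (sum_subset (range_mono (by omega)) fun q _ hq => ?_).symm
        rw [mem_range] at hq
        simp only [f]
        rw [if_neg (by omega)]; simp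
    _ = _ := by
        refine sum_congr rfl fun q hq => ?_
        simp only [f]
        rw [if_pos (by have := mem_range.1 hq; omega)]

end

/-! ### Comparison with g and the weighted count -/

section

/-- The cases of g follow the parity bounds: for odd X the surviving binomial gives `h`, and it
vanishes once X ≥ j - i. At X = 1 the exact value b - 1 is used and equality holds. -/
lemma truncCount_le_g {b j i X : ℕ} (hb : 2 ≤ b) (hij : i < j) (hj : j ≤ b) (hX : 1 ≤ X) :
    (b : ℝ) ^ (j - i) * truncCount b (j - i) X ≤
      (b : ℝ) ^ X * ((b : ℝ) - 1) ^ (j - i) * g b j i (X + 2 * i) := by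
  obtain ⟨r, hr⟩ : ∃ r, j - i = r + 1 := ⟨j - i - 1, by omega⟩
  have h1 := one_le_cast_sub_one hb
  have hb1 : (b : ℝ) - 1 ≠ 0 := by linarith
  have hb0 : (b : ℝ) ≠ 0 := by linarith
  rw [g, if_neg (by omega), hr, Nat.add_sub_cancel]
  have hpar : Even ((X : ℤ) + 2 * i) ↔ Even X := by
    rw [Int.even_add]; simp
  simp only [hpar]
  split_ifs with h2 h3
  · rw [mul_one]
    rcases Nat.even_or_odd X with he | ho
    · exact pow_mul_truncCount_le_of_even (by omega) (by omega) he
    · have h4 := pow_mul_truncCount_le_of_odd (by omega) (by omega : r + 1 ≤ b) ho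
      rcases h2 with h2 | h2
      · rw [Nat.choose_eq_zero_of_lt (by omega)] at h4
        simpa using h4
      · exact absurd ho (Nat.not_odd_iff_even.2 h2)
  · obtain rfl : X = 1 := by omega
    rw [truncCount_one, div_pow]
    refine le_of_eq ?_
    field_simp
    ring
  · rw [not_or, Nat.not_even_iff_odd] at h2
    have h4 := pow_mul_truncCount_le_of_odd (by omega) (by omega : r + 1 ≤ b) h2.2
    refine h4.trans_eq ?_
    have hz : (b : ℝ) ^ ((j : ℤ) + i - (X + 2 * i)) = (b : ℝ) ^ (r + 1) / (b : ℝ) ^ X := by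
      rw [← zpow_natCast, ← zpow_natCast, ← zpow_sub₀ hb0]
      congr 1
      omega
    rw [h, hz, hr, show ((X : ℤ) + 2 * i - 2 * i).toNat = X by omega, Nat.add_sub_cancel]
    field_simp

variable {b m s : ℕ} {P : Fin (b ^ m) → Fin s → ℝ}

lemma weightedCount_summand_le (hP : IsNet b 0 m P) (hb : 2 ≤ b) (hs : 0 < s) (hsb : s ≤ b)
    (hm : 1 ≤ m) (i : Fin (b ^ m)) (k : Fin s → ℕ) {J I : Finset (Fin s)} (hI : I ⊂ J) :
    (b : ℝ) ^ ((∑ j ∈ I ∪ Jᶜ, k j) + #J + #I) * ((b : ℝ) - 1) ^ ((#I : ℤ) - (#J : ℤ)) *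
      ((countNum b P k 0 2 J I i : ℝ) / ((b : ℝ) ^ m - 1)) ≤
    (b : ℝ) ^ m / ((b : ℝ) ^ m - 1) *
      g b #J #I (((m : ℤ) - ((∑ j ∈ I ∪ Jᶜ, k j : ℕ) : ℤ) - 2 * #I) + 2 * #I) := by
  have h1 := one_le_cast_sub_one hb
  have hb1 : (0 : ℝ) < (b : ℝ) - 1 := by linarith
  have hb0 : (0 : ℝ) < (b : ℝ) := by linarith
  have hn : 0 < (b : ℝ) ^ m - 1 := by
    have := one_lt_pow₀ (by linarith : 1 < (b : ℝ)) (by omega : m ≠ 0)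
    linarith
  have hlt := card_lt_card hI
  have hJ : #J ≤ b := (card_le_univ J).trans (by simpa using hsb)
  set A := ∑ j ∈ I ∪ Jᶜ, k j with hA
  rcases le_or_gt m (A + 2 * #I) with hle | hgt
  · rw [countNum_eq_zero hP hb hs i k hI.subset hle, g, if_pos (by omega)]
    simp
  obtain ⟨X, hX⟩ := Nat.exists_eq_add_of_le hgt.le
  have e1 : (m : ℤ) - (A : ℤ) - 2 * #I = X := by omega
  rw [countNum_eq_truncCount hP hb hs i k hI.subset hX.symm, e1]
  have hg := truncCount_le_g hb hlt hJ (by omega : 1 ≤ X)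
  -- From m = A + 2|I| + X, the exponent A + |J| + |I| equals m + (|J| - |I|) - X.
  have e2 : (b : ℝ) ^ (A + #J + #I) = (b : ℝ) ^ m * (b : ℝ) ^ (#J - #I) / (b : ℝ) ^ X := by
    rw [eq_div_iff (by positivity), ← pow_add, ← pow_add]
    congr 1
    omega
  have e3 : ((b : ℝ) - 1) ^ ((#I : ℤ) - (#J : ℤ)) = (((b : ℝ) - 1) ^ (#J - #I))⁻¹ := by
    rw [← zpow_natCast, ← zpow_neg]
    congr 1
    omega
  rw [e2, e3]
  have hpos : 0 < (b : ℝ) ^ X * ((b : ℝ) - 1) ^ (#J - #I) := by positivity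
  have hg' : (b : ℝ) ^ (#J - #I) * truncCount b (#J - #I) X /
      ((b : ℝ) ^ X * ((b : ℝ) - 1) ^ (#J - #I)) ≤ g b #J #I (X + 2 * #I) := by
    rw [div_le_iff₀ hpos]
    linarith
  refine le_trans (le_of_eq ?_) (mul_le_mul_of_nonneg_left hg' (by positivity))
  field_simp

lemma weightedCount_le_one (hP : IsNet b 0 m P) (hb : 2 ≤ b) (hsb : s ≤ b) (hm : 1 ≤ m)
    (J : Finset (Fin s)) (k : Fin s → ℕ) (hJm : #J ≤ m) (hmk : m < ∑ j, k j + 2 * #J)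
    (i : Fin (b ^ m)) : weightedCount b k 0 J P i ≤ 1 := by
  have hs : 0 < s := by
    rcases Nat.eq_zero_or_pos s with rfl | hs
    · have : #J ≤ 0 := by simpa using card_le_univ J
      simp at hmk; omega
    · exact hs
  have h1 := one_le_cast_sub_one hb
  have hn : 0 < (b : ℝ) ^ m - 1 := by
    have := one_lt_pow₀ (by linarith : 1 < (b : ℝ)) (by omega : m ≠ 0)
    linarith
  -- The term I = J, absent from G, vanishes because m < |k| + 2|J|.
  have hfull : (countNum b P k 0 2 J J i : ℝ) = 0 :=
    countNum_eq_zero hP hb hs i k Subset.rfl (by rw [union_compl]; exact hmk.le)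
  have hps : J.powerset = insert J J.ssubsets := by
    rw [ssubsets, insert_erase (mem_powerset_self J)]
  have hpow : (2 : ℝ) ^ #J ≤ (b : ℝ) ^ m :=
    (pow_le_pow_left₀ (by norm_num) (by linarith) _).trans
      (pow_le_pow_right₀ (by linarith) hJm)
  have hG := G_le (m := m) hb hsb J k
  rw [G_eq] at hG
  unfold weightedCount
  rw [hps, sum_insert (by simp [ssubsets]), hfull, zero_div, mul_zero, zero_add, one_div_mul_eq_div,
    div_le_one (by positivity)]
  calc _ ≤ ∑ I ∈ J.ssubsets, (b : ℝ) ^ m / ((b : ℝ) ^ m - 1) *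
        g b #J #I (((m : ℤ) - ((∑ j ∈ I ∪ Jᶜ, k j : ℕ) : ℤ) - 2 * #I) + 2 * #I) := by
        refine sum_le_sum fun I hI => ?_
        simpa using weightedCount_summand_le hP hb hs hsb hm i k (mem_ssubsets.1 hI)
    _ ≤ (b : ℝ) ^ m / ((b : ℝ) ^ m - 1) * (2 ^ #J - 1) := by
        rw [← mul_sum]
        exact mul_le_mul_of_nonneg_left hG (by positivity)
    _ ≤ 2 ^ #J := by
        -- After clearing denominators this is exactly 2^|J| ≤ b^m, the place where |J| ≤ m enters.
        rw [div_mul_eq_mul_div, div_le_iff₀ hn]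
        linarith

end

end Nets

end

theorem mainTheorem6 (b s m : ℕ) (hb : 2 ≤ b) (hsb : s ≤ b) (hm : 1 ≤ m)
    (J : Finset (Fin s)) (k : Fin s → ℕ)
    (hJm : J.card ≤ m) (hmk : m < (∑ j, k j) + 2 * J.card) :
    Nets.G b m s J k 0 ≤ 2 ^ J.card - 1 ∧
      ∀ P : Fin (b ^ m) → Fin s → ℝ, Nets.IsNet b 0 m P →
        ∀ i : Fin (b ^ m), Nets.weightedCount b k 0 J P i ≤ 1 :=
  ⟨Nets.G_le hb hsb J k, fun _ hP i =>
    Nets.weightedCount_le_one hP hb hsb hm J k hJm hmk i⟩
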